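/- Let $q$ be a power of a prime, $k_\infty=\mathbb{F}_q((1/\theta))$, and let $\mathbb{K}$ be the completion of an algebraic closure of $k_\infty$, with absolute value $|\cdot|$ normalized by $|\theta|=q$ and $\deg=\log_q|\cdot|$ (with $\deg 0=-\infty$). Let $\mathbb{T}=\{\sum c_it^i\in\mathbb{K}[[t]] : |c_i|\to 0\}$ be the Tate algebra with Gauss norm $\|\sum c_it^i\|=\max_i|c_i|$; for a matrix $F=(f_{ij})$ over $\mathbb{T}$ let $\|F\|=\max_{i,j}\|f_{ij}\|$. For $f=\sum c_it^i$ and $n\ge 0$ let $f^{(n)}=\sum c_i^{q^n}t^i$, and apply this entrywise to matrices. Let $r\geq 1$ and let $\phi:\mathbb{F}_q[t]\to\mathbb{K}[\tau]$ be a Drinfeld module of rank $r$, given by $\phi_t=\theta+A_1\tau+\dots+A_r\tau^r$ with $A_i\in\mathbb{K}$, $A_r\ne0$, where $\tau$ is the $q$-th power Frobenius; for $a\in\mathbb{F}_q[t]$ let $\phi[a]=\{x\in\mathbb{K}:\phi_a(x)=0\}$. Put \[ \Theta=\begin{pmatrix}0&1&\cdots&0\\ \vdots&\vdots&\ddots&\vdots\\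 0&0&\cdots&1\\ (t-\theta)/A_r&-A_1/A_r&\cdots&-A_{r-1}/A_r\end{pmatrix}\in\mathrm{Mat}_r(\mathbb{K}[t]). \] Let $R_\phi=|\theta|^{-\mu}$, where $\mu$ is the maximum of $(\deg A_n-q^n)/(q^n-1)$ over those $1\le n\le r$ with $A_n\neq0$. Put $A_0=\theta$. The Newton polygon of $\phi_t(x)=\theta x+A_1x^q+\dots+A_rx^{q^r}$ is the lower boundary of the convex hull of the points $(q^i,-\deg A_i)$, $0\le i\le r$, $A_i\ne0$. Let $(q^{d_k},-\deg A_{d_k})$, $0=d_0<d_1<\dots<d_s=r$, be its vertices and $\lambda_1<\dots<\lambda_s$ the slopes of its successive edges. An $\mathbb{F}_q$-basis $x_1,\dots,x_r$ of $\phi[t]$ is called strict if $\deg x_j=\lambda_k$ whenever $d_{k-1}+1\le j\le d_k$. Theorem. Let $x_1,\dots,x_r$ be a strict basis of $\phi[t]$, and let $N\ge1$ and $\xi_1,\dots,\xi_r\in\phi[t^N]$ be such that for every $j$: (1) $|\xi_j|<R_\phi$; (2) $\phi_{t^{N-1}}(\xi_j)=x_j$; (3) $\deg\phi_{t^{N-1}}(\xi_j)>\dots>\deg\phi_t(\xi_j)>\deg\xi_j$.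 Set \[ h_j=\sum_{m=0}^{N-1}\phi_{t^{N-1-m}}(\xi_j)\,t^m\in\mathbb{K}[t],\qquad B=\bigl(h_j^{(i-1)}\bigr)_{1\le i,j\le r}\in\mathrm{Mat}_r(\mathbb{K}[t]). \] Then $\Theta,B\in\mathrm{GL}_r(\mathbb{T})$ and \[ \bigl\|B^{-1}\Theta^{-1}B^{(1)}-I\bigr\|<1, \] where $I$ is the $r\times r$ identity matrix. -/

import Mathlib

noncomputable section

open Polynomial

namespace Drinfeld

/-! ### The fields `k_∞` and `𝕂` -/

section Fields

variable (Fq : Type*) [Field Fq]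

instance decEqRatFunc : DecidableEq (RatFunc Fq) := Classical.decEq _

/-- `k_∞ = 𝔽_q((1/θ))`, the completion of `k = 𝔽_q(θ)` at its infinite place; the variable of
`RatFunc Fq` plays the role of `θ`. -/
abbrev KInfty : Type _ := RatFunc.CompletionAtInfty Fq

/-- `θ` as an element of `k_∞`. -/
def thetaInfty : KInfty Fq := algebraMap (RatFunc Fq) (KInfty Fq) RatFunc.X

section

attribute [-instance] RatFunc.valuedRatFunc
attribute [local instance] RatFunc.inftyValued

instance : CompleteSpace (KInfty Fq) :=
  inferInstanceAs (CompleteSpace (UniformSpace.Completion (RatFunc Fq)))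

theorem v_thetaInfty :
    (Valued.v (thetaInfty Fq) : WithZero (Multiplicative ℤ)) = WithZero.exp 1 := by
  refine (Valued.extensionValuation_apply_coe (K := RatFunc Fq) (RatFunc.X : RatFunc Fq)).trans ?_
  exact RatFunc.inftyValuation.X Fq

end

variable [Fintype Fq]

theorem one_lt_card : (1 : NNReal) < (Fintype.card Fq : NNReal) := by
  exact_mod_cast Fintype.one_lt_card

/-- The `∞`-adic valuation is turned into a real absolute value by `exp n ↦ q ^ n`, so that
`|θ| = q`. -/
instance : Valuation.RankOne
    (Valued.v : Valuation (KInfty Fq) (WithZero (Multiplicative ℤ))) where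
  hom' := (WithZeroMulInt.toNNReal (one_lt_card Fq).ne_zero).comp
    MonoidWithZeroHom.ValueGroup₀.embedding
  strictMono' := (WithZeroMulInt.toNNReal_strictMono (one_lt_card Fq)).comp
    MonoidWithZeroHom.ValueGroup₀.embedding_strictMono
  exists_val_nontrivial := ⟨thetaInfty Fq, by rw [v_thetaInfty]; simp, by rw [v_thetaInfty]; simp⟩

instance : NontriviallyNormedField (KInfty Fq) :=
  Valued.toNontriviallyNormedField (KInfty Fq) (WithZero (Multiplicative ℤ))

instance : IsUltrametricDist (KInfty Fq) :=
  inferInstanceAs (@IsUltrametricDist (KInfty Fq)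
    (Valued.toNormedField (KInfty Fq) (WithZero (Multiplicative ℤ))).toDist)

theorem norm_thetaInfty : ‖thetaInfty Fq‖ = Fintype.card Fq := by
  have h : ‖thetaInfty Fq‖ = ((WithZeroMulInt.toNNReal (one_lt_card Fq).ne_zero
      (MonoidWithZeroHom.ValueGroup₀.embedding
        ((Valued.v : Valuation (KInfty Fq) (WithZero (Multiplicative ℤ))).restrict
          (thetaInfty Fq))) : NNReal) : ℝ) := rfl
  have h1 : WithZeroMulInt.toNNReal (one_lt_card Fq).ne_zero (WithZero.exp (1 : ℤ)) =
      (Fintype.card Fq : NNReal) ^ (1 : ℤ) :=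
    WithZeroMulInt.toNNReal_neg_apply _ WithZero.coe_ne_zero
  rw [h, Valuation.embedding_restrict, v_thetaInfty, h1]
  simp

/-- An algebraic closure of `k_∞`. -/
abbrev KInftyAlg : Type _ := AlgebraicClosure (KInfty Fq)

/-- The unique extension of the absolute value of `k_∞` to its algebraic closure. -/
instance : NormedField (KInftyAlg Fq) := spectralNorm.normedField (KInfty Fq) (KInftyAlg Fq)

instance : NormedAlgebra (KInfty Fq) (KInftyAlg Fq) := spectralNorm.normedAlgebra _ _

/-- `𝕂`, the completion of an algebraic closure of `k_∞`. -/
abbrev CInfty : Type _ := UniformSpace.Completion (KInftyAlg Fq)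

instance : NormedField (CInfty Fq) := inferInstance

instance : IsUltrametricDist (CInfty Fq) := IsUltrametricDist.of_normedAlgebra (KInfty Fq)

instance : CompleteSpace (CInfty Fq) := inferInstance

/-- `𝕂` as an extension of `𝔽_q`. -/
instance : Algebra Fq (CInfty Fq) :=
  ((algebraMap (KInfty Fq) (CInfty Fq)).comp
    ((algebraMap (RatFunc Fq) (KInfty Fq)).comp (algebraMap Fq (RatFunc Fq)))).toAlgebra

/-- `θ` as an element of `𝕂`. -/
def theta : CInfty Fq := algebraMap (KInfty Fq) (CInfty Fq) (thetaInfty Fq)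

theorem norm_theta : ‖theta Fq‖ = Fintype.card Fq := by
  rw [theta, norm_algebraMap', norm_thetaInfty]

end Fields

/-! ### The Tate algebra and the Gauss norm -/

section Tate

variable (K : Type*) [NormedField K] [IsUltrametricDist K]

/-- The Tate algebra `𝕋` of power series over `K` whose coefficients tend to `0`. -/
abbrev Tate : Type _ := PowerSeries.IsRestricted.subring (R := K) 1

theorem coe_mem_tate (p : K[X]) :
    (p : PowerSeries K) ∈ PowerSeries.IsRestricted.subring (R := K) 1 := by
  change PowerSeries.IsRestricted 1 (p : PowerSeries K)
  rw [PowerSeries.isRestricted_iff']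
  refine tendsto_const_nhds.congr' ?_
  filter_upwards [Filter.eventually_gt_atTop p.natDegree] with n hn
  simp [Polynomial.coeff_eq_zero_of_natDegree_lt hn]

/-- The inclusion `K[t] ⊆ 𝕋`. -/
def toTate : K[X] →+* Tate K :=
  (Polynomial.coeToPowerSeries.ringHom (R := K)).codRestrict _ (coe_mem_tate K)

variable {K}

/-- The Gauss norm `‖∑ c_i t^i‖ = sup_i |c_i|` on `𝕋`. -/
def gaussNorm (f : Tate K) : ℝ := PowerSeries.gaussNorm (fun c : K => ‖c‖) 1 f.1

/-- The Gauss norm of a matrix over `𝕋`: the maximum of the Gauss norms of its entries. -/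
def matGaussNorm {m n : ℕ} (F : Matrix (Fin m) (Fin n) (Tate K)) : ℝ :=
  ⨆ p : Fin m × Fin n, gaussNorm (F p.1 p.2)

end Tate

/-! ### Drinfeld modules -/

section Modules

variable (Fq : Type*) [Field Fq] [Fintype Fq]

/-- A Drinfeld module of rank `r ≥ 1` over `K`, given by the coefficients of
`φ_t = θ + A_1 τ + ⋯ + A_r τ^r` with `A_r ≠ 0`; here `coeff 0 = θ` and `coeff i = A_i`. -/
structure DrinfeldModule (K : Type*) [Field K] (θ : K) (r : ℕ) where
  rank_pos : 0 < r
  coeff : Fin (r + 1) → K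
  coeff_zero : coeff 0 = θ
  coeff_last : coeff (Fin.last r) ≠ 0

variable {K : Type*} [NormedField K] [Algebra Fq K]

/-- The degree `deg = -v_∞ = log_q |·|` (used for nonzero elements only). -/
def deg (x : K) : ℝ := Real.logb (Fintype.card Fq) ‖x‖

/-- The `q`-th power Frobenius `τ`, as an `𝔽_q`-linear endomorphism of `K`. -/
def tau : Module.End Fq K := (FiniteField.frobeniusAlgHom Fq K).toLinearMap

/-- The `n`-th Frobenius twist `∑ c_i t^i ↦ ∑ c_i^(q^n) t^i` on `K[t]`. -/
def twist (n : ℕ) : K[X] →+* K[X] :=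
  Polynomial.mapRingHom ((FiniteField.frobeniusAlgHom Fq K) ^ n : K →ₐ[Fq] K)

namespace DrinfeldModule

variable {θ : K} {r : ℕ} (φ : DrinfeldModule K θ r)

/-- `φ_t` as an operator on `K`, `x ↦ θ x + A_1 x^q + ⋯ + A_r x^(q^r)`. -/
def phiT : Module.End Fq K :=
  ∑ i : Fin (r + 1), LinearMap.mulLeft Fq (φ.coeff i) * tau Fq ^ (i : ℕ)

/-- The ring homomorphism `a ↦ φ_a` from `𝔽_q[t]`. A twisted polynomial in `K[τ]` is regarded as
the `𝔽_q`-linear operator on `K` that it defines (for infinite `K` this embeds `K[τ]` into the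
ring of such operators). -/
def hom : Fq[X] →ₐ[Fq] Module.End Fq K := Polynomial.aeval (φ.phiT Fq)

/-- The `a`-torsion `φ[a] = {x ∈ K : φ_a(x) = 0}`. -/
def torsion (a : Fq[X]) : Submodule Fq K := LinearMap.ker (φ.hom Fq a)

/-- `N(φ) = {1 ≤ i ≤ r : A_i ≠ 0}`. -/
def support : Finset (Fin (r + 1)) :=
  open Classical in Finset.univ.filter fun i => i ≠ 0 ∧ φ.coeff i ≠ 0

theorem support_nonempty : φ.support.Nonempty := by
  refine ⟨Fin.last r, ?_⟩
  simp only [support, Finset.mem_filter, Finset.mem_univ, true_and]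
  exact ⟨fun h => φ.rank_pos.ne' (congrArg Fin.val h), φ.coeff_last⟩

/-- `μ_n = (deg A_n - q^n) / (q^n - 1)`. -/
def mu (n : Fin (r + 1)) : ℝ :=
  (deg Fq (φ.coeff n) - (Fintype.card Fq : ℝ) ^ (n : ℕ)) /
    ((Fintype.card Fq : ℝ) ^ (n : ℕ) - 1)

/-- `R_φ = |θ|^(-μ)`, where `μ` is the largest of the numbers `μ_n`, `n ∈ N(φ)`. -/
def radius : ℝ := ‖θ‖ ^ (-(φ.support.sup' φ.support_nonempty (φ.mu Fq)))

/-- The slope `w_{n,m}` of the segment from `(q^n, -deg A_n)` to `(q^m, -deg A_m)`. -/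
def slope (n m : Fin (r + 1)) : ℝ :=
  (-deg Fq (φ.coeff m) - -deg Fq (φ.coeff n)) /
    ((Fintype.card Fq : ℝ) ^ (m : ℕ) - (Fintype.card Fq : ℝ) ^ (n : ℕ))

/-- The Newton polygon of `φ_t(x) = θ x + A_1 x^q + ⋯ + A_r x^(q^r)`, i.e. the lower boundary of the
convex hull of the points `(q^i, -deg A_i)` with `A_i ≠ 0` (where `A_0 = θ`), has exactly `s` edges,
and its vertices are the points with indices `0 = d_0 < d_1 < ⋯ < d_s = r`. -/
structure IsNewtonPolygon (s : ℕ) (d : Fin (s + 1) → Fin (r + 1)) : Prop where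
  strictMono : StrictMono d
  first : d 0 = 0
  last : d (Fin.last s) = Fin.last r
  coeff_ne_zero : ∀ k, φ.coeff (d k) ≠ 0
  slope_strictMono : StrictMono fun k : Fin s => φ.slope Fq (d k.castSucc) (d k.succ)
  le_above : ∀ (k : Fin s) (i : Fin (r + 1)), φ.coeff i ≠ 0 →
    -deg Fq (φ.coeff (d k.castSucc)) + φ.slope Fq (d k.castSucc) (d k.succ) *
      ((Fintype.card Fq : ℝ) ^ (i : ℕ) - (Fintype.card Fq : ℝ) ^ (d k.castSucc : ℕ)) ≤
    -deg Fq (φ.coeff i)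

variable {Fq}

/-- An `𝔽_q`-basis `x_1, …, x_r` of `φ[t]` is strict if `deg x_j = λ_k` whenever
`d_{k-1} + 1 ≤ j ≤ d_k`, where `λ_k` is the slope of the `k`-th edge of the Newton polygon of
`φ_t(x)`. Here `x_1, …, x_r` are indexed from `0`. -/
def IsStrict (x : Module.Basis (Fin r) Fq (φ.torsion Fq X)) : Prop :=
  ∃ (s : ℕ) (d : Fin (s + 1) → Fin (r + 1)), φ.IsNewtonPolygon Fq s d ∧
    ∀ (k : Fin s) (j : Fin r), (d k.castSucc : ℕ) ≤ j → (j : ℕ) < d k.succ →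
      deg Fq (x j : K) = φ.slope Fq (d k.castSucc) (d k.succ)

/-- The conditions on the choice of `N ≥ 1` and of `ξ_1, …, ξ_r ∈ φ[t^N]` above the basis
`x_1, …, x_r` of `φ[t]`. -/
structure IsDivisionChoice (x : Module.Basis (Fin r) Fq (φ.torsion Fq X)) (N : ℕ)
    (ξ : Fin r → K) : Prop where
  one_le : 1 ≤ N
  mem_torsion : ∀ j, ξ j ∈ φ.torsion Fq (X ^ N)
  norm_lt_radius : ∀ j, ‖ξ j‖ < φ.radius Fq
  map_eq : ∀ j, φ.hom Fq (X ^ (N - 1)) (ξ j) = x j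
  norm_lt_norm : ∀ j m, m + 1 < N →
    ‖φ.hom Fq (X ^ m) (ξ j)‖ < ‖φ.hom Fq (X ^ (m + 1)) (ξ j)‖

variable (Fq)

/-- `h = φ_{t^(N-1)}(ξ) + φ_{t^(N-2)}(ξ) t + ⋯ + ξ t^(N-1) ∈ K[t]`. -/
def h (N : ℕ) (ξ : K) : K[X] :=
  ∑ m ∈ Finset.range N, C (φ.hom Fq (X ^ (N - 1 - m)) ξ) * X ^ m

/-- The matrix `B = (h_j^(i-1))` over `K[t]` (rows and columns are indexed from `0`). -/
def matB (N : ℕ) (ξ : Fin r → K) : Matrix (Fin r) (Fin r) K[X] :=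
  Matrix.of fun i j => twist Fq i (φ.h Fq N (ξ j))

/-- The matrix `Θ` over `K[t]`: ones above the diagonal, and last row
`((t - θ)/A_r, -A_1/A_r, …, -A_{r-1}/A_r)`. -/
def matTheta : Matrix (Fin r) (Fin r) K[X] :=
  Matrix.of fun i j =>
    if (i : ℕ) + 1 = r then
      if (j : ℕ) = 0 then C (φ.coeff (Fin.last r))⁻¹ * (X - C θ)
      else -C (φ.coeff j.castSucc / φ.coeff (Fin.last r))
    else if (j : ℕ) = i + 1 then 1 else 0

end DrinfeldModule

end Modules

end Drinfeld

end

/-! Write `x_0, …, x_{r-1}` for the basis. The torsion condition on `ξ_j` says that `φ_t`, acting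
through Frobenius twists, sends `h_j` to `t h_j - ξ_j t^N`. Hence `Θ B` and `B^(1)` agree except in
the last row, where they differ by `A_r⁻¹ ξ_j t^N`. The first column of `Θ` has `(t - θ)/A_r` as its
only nonzero entry, in that same row, so the error can be moved to the other side: `B^(1) = Θ (B -
F)`, where `F` has first row `ξ_j t^N / (t - θ)` and zeros elsewhere. Consequently `B⁻¹ Θ⁻¹ B^(1) -
I = -B⁻¹ F`, and only the first column of `B⁻¹` matters.

That column has norm at most `|x_0|⁻¹` (`exists_twistMatrix_mul_eq_one`). As `(t - θ)⁻¹` has norm at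
most `|θ|⁻¹`, the entries of `B⁻¹ F` are bounded by `|ξ_j| / (|θ| |x_0|)`. This is less than `1`
because `|ξ_j| < R_φ ≤ |θ| |x_0|`, the last inequality coming from the first edge of the Newton
polygon (`IsStrict.radius_le`).

For the bound on `B⁻¹`: the constant term `x_j` of `h_j` strictly dominates its other coefficients,
so after diagonal scaling of rows and columns `B` is integral and reduces to a constant matrix, a
scaled Moore matrix of the `x_j`. Moore's product formula expresses its determinant through the
differences of `x_j` and `𝔽_q`-combinations of earlier basis vectors. A strict basis is orthogonal
(`IsStrict.norm_le_norm_sub`), by counting zeros of `φ_t` in a disc, so none of these differences is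
smaller than `x_j`. The scaled determinant therefore has norm `1` and is a unit of `𝕋`. -/

noncomputable section

open Polynomial

namespace Drinfeld

/-! ### Polynomials over an ultrametric field: zeros in discs, units of the Tate algebra -/

section Ultrametric

variable {K : Type*} [NormedField K] [IsUltrametricDist K]

/-- Comparing coefficients gives `Q_i = P_{i+1} + x Q_{i+1}`, and multiplication by `x` costs at
most a factor `ρ`, so the weighted bound passes from `Q_{i+1}` to `Q_i`. -/
theorem norm_coeff_le_of_eq_X_sub_C_mul {ρ M : ℝ} (hρ : 0 < ρ) (hM : 0 ≤ M) {P Q : K[X]} {x : K}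
    (hx : ‖x‖ ≤ ρ) (hPQ : P = (X - C x) * Q) (hP : ∀ i, ‖P.coeff i‖ * ρ ^ i ≤ M) (i : ℕ) :
    ‖Q.coeff i‖ * ρ ^ (i + 1) ≤ M := by
  -- Downward induction on `i`, starting above the degree of `Q`, where the coefficients vanish.
  suffices h : ∀ k i, Q.natDegree < i + k → ‖Q.coeff i‖ * ρ ^ (i + 1) ≤ M from
    h (Q.natDegree + 1) i (by omega)
  intro k
  induction k with
  | zero =>
    intro i hi
    rw [coeff_eq_zero_of_natDegree_lt (by omega)]
    simpa using hM
  | succ k ih =>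
    intro i hi
    have h1 := ih (i + 1) (by omega)
    have h2 : Q.coeff i = P.coeff (i + 1) + x * Q.coeff (i + 1) := by
      rw [hPQ, sub_mul, coeff_sub, coeff_X_mul, coeff_C_mul]; ring
    have h3 : ‖Q.coeff i‖ ≤ max ‖P.coeff (i + 1)‖ ‖x * Q.coeff (i + 1)‖ := by
      rw [h2]; exact IsUltrametricDist.norm_add_le_max _ _
    have h4 : ‖x * Q.coeff (i + 1)‖ * ρ ^ (i + 1) ≤ M := by
      refine le_trans ?_ h1
      rw [norm_mul, pow_succ ρ (i + 1)]
      calc ‖x‖ * ‖Q.coeff (i + 1)‖ * ρ ^ (i + 1) ≤ ρ * ‖Q.coeff (i + 1)‖ * ρ ^ (i + 1) := by gcongr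
        _ = _ := by ring
    refine (mul_le_mul_of_nonneg_right h3 (by positivity)).trans ?_
    rw [max_mul_of_nonneg _ _ (by positivity)]
    exact max_le (hP _) h4

/-- If the term of degree `D` of `P` dominates on the circle of radius `ρ`, then `P` has at most `D`
zeros in the open disc of radius `ρ`. -/
theorem card_roots_le_of_dominant_coeff {ρ : ℝ} (hρ : 0 < ρ) {P : K[X]} {D : ℕ}
    (hD : P.coeff D ≠ 0) (hP : ∀ i, ‖P.coeff i‖ * ρ ^ i ≤ ‖P.coeff D‖ * ρ ^ D) (S : Finset K)
    (hS : ∀ x ∈ S, ‖x‖ < ρ ∧ P.IsRoot x) : S.card ≤ D := by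
  classical
  induction D generalizing P S with
  | zero =>
    by_contra hc
    obtain ⟨x, hx⟩ : S.Nonempty := Finset.card_pos.mp (by omega)
    obtain ⟨Q, hQ⟩ := dvd_iff_isRoot.mpr (hS x hx).2
    have h1 := norm_coeff_le_of_eq_X_sub_C_mul hρ (by positivity) (hS x hx).1.le hQ hP 0
    have h2 : P.coeff 0 = -(x * Q.coeff 0) := by
      rw [hQ, sub_mul, coeff_sub, coeff_C_mul]; simp
    have h3 : Q.coeff 0 ≠ 0 := by
      intro h0; apply hD; rw [h2, h0]; simp
    have h4 : ‖P.coeff 0‖ = ‖x‖ * ‖Q.coeff 0‖ := by rw [h2, norm_neg, norm_mul]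
    have h5 : ‖x‖ * ‖Q.coeff 0‖ < ρ * ‖Q.coeff 0‖ :=
      mul_lt_mul_of_pos_right (hS x hx).1 (norm_pos_iff.mpr h3)
    simp only [zero_add, pow_one, pow_zero, mul_one] at h1
    linarith
  | succ D ih =>
    rcases S.eq_empty_or_nonempty with rfl | ⟨x, hx⟩
    · simp
    obtain ⟨Q, hQ⟩ := dvd_iff_isRoot.mpr (hS x hx).2
    have h1 := norm_coeff_le_of_eq_X_sub_C_mul hρ (by positivity) (hS x hx).1.le hQ hP
    have h2 : Q.coeff D = P.coeff (D + 1) + x * Q.coeff (D + 1) := by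
      rw [hQ, sub_mul, coeff_sub, coeff_X_mul, coeff_C_mul]; ring
    have h3 : ‖x * Q.coeff (D + 1)‖ < ‖P.coeff (D + 1)‖ := by
      by_cases h0 : Q.coeff (D + 1) = 0
      · simpa [h0] using hD
      rw [norm_mul]
      have h4 := h1 (D + 1)
      have h5 : ‖x‖ * ‖Q.coeff (D + 1)‖ < ρ * ‖Q.coeff (D + 1)‖ :=
        mul_lt_mul_of_pos_right (hS x hx).1 (norm_pos_iff.mpr h0)
      refine h5.trans_le (le_of_mul_le_mul_right ?_ (pow_pos hρ (D + 1)))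
      refine le_trans (le_of_eq ?_) h4
      ring
    -- Removing a zero from the open disc shifts the dominant term down by exactly one degree.
    have h4 : ‖Q.coeff D‖ = ‖P.coeff (D + 1)‖ := by
      rw [h2, IsUltrametricDist.norm_add_eq_max_of_norm_ne_norm h3.ne', max_eq_left h3.le]
    have h5 := ih (P := Q) (norm_pos_iff.mp (by rw [h4]; exact norm_pos_iff.mpr hD))
      (fun i => by
        refine le_of_mul_le_mul_right ?_ hρ
        have := h1 i
        rw [← h4] at this
        calc _ = ‖Q.coeff i‖ * ρ ^ (i + 1) := by ring
          _ ≤ _ := this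
          _ = _ := by ring) (S.erase x)
      (fun y hy => by
        obtain ⟨hyx, hyS⟩ := Finset.mem_erase.mp hy
        refine ⟨(hS y hyS).1, ?_⟩
        have := (hS y hyS).2
        rw [hQ, IsRoot, eval_mul, mul_eq_zero] at this
        refine this.resolve_left ?_
        simpa [sub_eq_zero] using hyx)
    rw [Finset.card_erase_of_mem hx] at h5
    omega

variable (K) in
/-- Polynomials that reduce to a constant in the residue field. -/
def reducesToConst : Subring K[X] where
  carrier := {p | ‖p.coeff 0‖ ≤ 1 ∧ ∀ i ≠ 0, ‖p.coeff i‖ < 1}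
  zero_mem' := by simp
  one_mem' := by
    refine ⟨by simp, fun i hi => ?_⟩
    simp [coeff_one, hi]
  add_mem' := fun {p q} hp hq => by
    refine ⟨?_, fun i hi => ?_⟩
    · rw [coeff_add]
      exact (IsUltrametricDist.norm_add_le_max _ _).trans (max_le hp.1 hq.1)
    · rw [coeff_add]
      exact (IsUltrametricDist.norm_add_le_max _ _).trans_lt (max_lt (hp.2 i hi) (hq.2 i hi))
  neg_mem' := fun {p} hp => by simpa using hp
  mul_mem' := fun {p q} hp hq => by
    have hp' : ∀ i, ‖p.coeff i‖ ≤ 1 := fun i => by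
      rcases eq_or_ne i 0 with rfl | h
      exacts [hp.1, (hp.2 i h).le]
    have hq' : ∀ i, ‖q.coeff i‖ ≤ 1 := fun i => by
      rcases eq_or_ne i 0 with rfl | h
      exacts [hq.1, (hq.2 i h).le]
    refine ⟨?_, fun i hi => ?_⟩
    · rw [mul_coeff_zero, norm_mul]
      exact mul_le_one₀ hp.1 (norm_nonneg _) hq.1
    · rw [coeff_mul]
      obtain ⟨k, hk, hle⟩ := IsUltrametricDist.exists_norm_finsetSum_le_of_nonempty
        (t := Finset.HasAntidiagonal.antidiagonal i) ⟨(0, i), Finset.HasAntidiagonal.mem_antidiagonal.mpr (zero_add i)⟩ fun k => p.coeff k.1 * q.coeff k.2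
      refine hle.trans_lt ?_
      rw [Finset.HasAntidiagonal.mem_antidiagonal] at hk
      rw [norm_mul]
      by_cases h : k.1 = 0
      · exact mul_lt_one_of_nonneg_of_lt_one_right (hp' _) (norm_nonneg _) (hq.2 _ (by omega))
      · exact mul_lt_one_of_nonneg_of_lt_one_left (norm_nonneg _) (hp.2 _ h) (hq' _)

theorem norm_coeff_le_one_of_mem {p : K[X]} (hp : p ∈ reducesToConst K) (i : ℕ) :
    ‖p.coeff i‖ ≤ 1 := by
  rcases eq_or_ne i 0 with rfl | h
  exacts [hp.1, (hp.2 i h).le]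

/-- Only finitely many coefficients are nonzero, so any `δ < 1` close enough to `1` works. A
geometric bound, unlike a mere bound by `1`, is inherited by the inverse power series and forces its
coefficients to tend to `0`. -/
theorem exists_norm_coeff_le_pow {p : K[X]} (hp : p ∈ reducesToConst K) :
    ∃ δ : ℝ, 0 < δ ∧ δ < 1 ∧ ∀ i, ‖p.coeff i‖ ≤ δ ^ i := by
  have h1 : ∀ᶠ δ : ℝ in nhdsWithin 1 (Set.Iio 1),
      ∀ i ∈ Finset.range (p.natDegree + 1), ‖p.coeff i‖ ≤ δ ^ i := by
    rw [Filter.eventually_all_finset]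
    intro i _
    rcases eq_or_ne i 0 with rfl | hi
    · exact Filter.Eventually.of_forall fun δ => by simpa using hp.1
    · have : Filter.Tendsto (fun δ : ℝ => δ ^ i) (nhdsWithin 1 (Set.Iio 1)) (nhds 1) := by
        have h := ((continuous_pow (M := ℝ) i).tendsto 1).mono_left
          (nhdsWithin_le_nhds (s := Set.Iio 1))
        simpa using h
      exact (this.eventually (lt_mem_nhds (hp.2 i hi))).mono fun _ h => h.le
  have h2 : ∀ᶠ δ : ℝ in nhdsWithin 1 (Set.Iio 1), 0 < δ :=
    Filter.Eventually.filter_mono nhdsWithin_le_nhds (lt_mem_nhds one_pos)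
  obtain ⟨δ, ⟨h, hpos⟩, hlt⟩ := ((h1.and h2).and self_mem_nhdsWithin).exists
  refine ⟨δ, hpos, hlt, fun i => ?_⟩
  by_cases hi : i ≤ p.natDegree
  · exact h i (Finset.mem_range.mpr (by omega))
  · rw [coeff_eq_zero_of_natDegree_lt (by omega)]
    simpa using (pow_pos hpos i).le

/-- A polynomial which reduces to a nonzero constant is a unit of `𝕋`, of Gauss norm `1`. -/
theorem exists_toTate_mul_eq_one {p : K[X]} (hp : p ∈ reducesToConst K) (h0 : ‖p.coeff 0‖ = 1) :
    ∃ g : Tate K, toTate K p * g = 1 ∧ ∀ m, ‖PowerSeries.coeff m g.1‖ ≤ 1 := by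
  obtain ⟨δ, hδ, hδ1, hpδ⟩ := exists_norm_coeff_le_pow hp
  have hc : PowerSeries.constantCoeff (p : PowerSeries K) = p.coeff 0 := by simp
  -- The recursion for the coefficients of the inverse involves products of coefficients of indices
  -- `k` and `m - k`, bounded by `δ ^ k * δ ^ (m - k)`.
  have hw : ∀ m, ‖PowerSeries.coeff m (p : PowerSeries K)⁻¹‖ ≤ δ ^ m := by
    intro m
    induction m using Nat.strong_induction_on with
    | _ m ih =>
      rw [PowerSeries.coeff_inv]
      split_ifs with hm
      · subst hm
        rw [hc, norm_inv, h0]; simp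
      · rw [hc, norm_mul, norm_neg, norm_inv, h0, inv_one, one_mul]
        refine IsUltrametricDist.norm_sum_le_of_forall_le_of_nonneg (by positivity) fun k hk => ?_
        rw [Finset.HasAntidiagonal.mem_antidiagonal] at hk
        split_ifs with hlt
        · rw [norm_mul, ← hk, pow_add]
          refine mul_le_mul ?_ (ih _ hlt) (norm_nonneg _) (by positivity)
          simpa using hpδ k.1
        · simpa using (pow_pos hδ m).le
  refine ⟨⟨(p : PowerSeries K)⁻¹, ?_⟩, ?_, fun m => (hw m).trans (pow_le_one₀ hδ.le hδ1.le)⟩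
  · change PowerSeries.IsRestricted 1 _
    rw [PowerSeries.isRestricted_iff']
    refine squeeze_zero (fun _ => by positivity) (fun m => ?_)
      (tendsto_pow_atTop_nhds_zero_of_lt_one hδ.le hδ1)
    simpa using hw m
  · apply Subtype.ext
    refine PowerSeries.mul_inv_cancel (p : PowerSeries K) ?_
    rw [hc]
    exact norm_ne_zero_iff.mp (by rw [h0]; exact one_ne_zero)

end Ultrametric

/-! ### The Moore determinant -/

section Moore

variable (Fq : Type*) [Field Fq] [Fintype Fq] {K : Type*} [Field K] [Algebra Fq K]

/-- The Moore matrix `(x_j ^ (q ^ i))`. -/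
def moore {n : ℕ} (x : Fin n → K) : Matrix (Fin n) (Fin n) K :=
  Matrix.of fun i j => x j ^ Fintype.card Fq ^ (i : ℕ)

variable {Fq}

theorem sum_smul_pow_card_pow {ι : Type*} (s : Finset ι) (c : ι → Fq) (x : ι → K) (i : ℕ) :
    (∑ l ∈ s, c l • x l) ^ Fintype.card Fq ^ i = ∑ l ∈ s, c l • x l ^ Fintype.card Fq ^ i := by
  have h : ∀ y : K, ((FiniteField.frobeniusAlgHom Fq K) ^ i) y = y ^ Fintype.card Fq ^ i := by
    intro y
    rw [AlgHom.coe_pow, FiniteField.coe_frobeniusAlgHom, pow_iterate]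
  simp only [← h, map_sum, map_smul]

/-- Powers by `q ^ i` are `𝔽_q`-linear, so every row satisfies the same linear relation and the last
column depends on the others. -/
theorem det_moore_snoc_eq_zero {n : ℕ} (x : Fin n → K) (c : Fin n → Fq) :
    (moore Fq (Fin.snoc x (∑ l, c l • x l) : Fin (n + 1) → K)).det = 0 := by
  rw [← Matrix.exists_mulVec_eq_zero_iff]
  refine ⟨Fin.snoc (fun l => algebraMap Fq K (c l)) (-1), fun h => ?_, ?_⟩
  · have := congrFun h (Fin.last n)
    simp at this
  · ext i
    simp only [Matrix.mulVec, dotProduct, Fin.sum_univ_castSucc, moore, Matrix.of_apply,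
      Fin.snoc_castSucc, Fin.snoc_last, Pi.zero_apply, sum_smul_pow_card_pow]
    simp only [Algebra.smul_def]
    rw [mul_neg, mul_one, ← sub_eq_add_neg, sub_eq_zero]
    exact Finset.sum_congr rfl fun l _ => mul_comm _ _

/-- Moore's recursion for the Moore determinant. -/
theorem det_moore_snoc {n : ℕ} (x : Fin n → K) (hx : LinearIndependent Fq x) (y : K) :
    (moore Fq (Fin.snoc x y : Fin (n + 1) → K)).det =
      (moore Fq x).det * ∏ c : Fin n → Fq, (y - ∑ l, c l • x l) := by
  classical
  -- `F` is the determinant as a polynomial in the last variable, expanded along the last column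
  -- with cofactors `a i`; `G` is the claimed product.
  set a : Fin (n + 1) → K := fun i => (-1) ^ ((i : ℕ) + n) *
    (Matrix.of fun k l : Fin n => x l ^ Fintype.card Fq ^ (i.succAbove k : ℕ)).det with ha
  set F : K[X] := ∑ i : Fin (n + 1), C (a i) * X ^ Fintype.card Fq ^ (i : ℕ) with hF
  set G : K[X] := C (moore Fq x).det * ∏ c : Fin n → Fq, (X - C (∑ l, c l • x l)) with hG
  have hq : 1 < Fintype.card Fq := Fintype.one_lt_card
  have hlast : a (Fin.last n) = (moore Fq x).det := by
    simp only [ha, Fin.val_last, Fin.succAbove_last, Fin.val_castSucc, moore]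
    rw [← two_mul, pow_mul]; simp
  have hFeval : ∀ z, F.eval z = (moore Fq (Fin.snoc x z : Fin (n + 1) → K)).det := by
    intro z
    rw [Matrix.det_succ_column _ (Fin.last n), hF, eval_finsetSum]
    refine Finset.sum_congr rfl fun i _ => ?_
    simp only [eval_mul, eval_C, eval_pow, eval_X, ha, moore, Matrix.of_apply, Fin.snoc_last,
      Fin.val_last, Fin.succAbove_last]
    rw [mul_right_comm]
    congr 2
    ext k l
    simp
  have hprod : (∏ c : Fin n → Fq, (X - C (∑ l, c l • x l))).Monic :=
    monic_prod_of_monic _ _ fun c _ => monic_X_sub_C _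
  have hdeg : (∏ c : Fin n → Fq, (X - C (∑ l, c l • x l))).natDegree = Fintype.card Fq ^ n := by
    rw [natDegree_prod_of_monic _ _ fun c _ => monic_X_sub_C _]
    simp only [natDegree_X_sub_C, Finset.sum_const, Finset.card_univ, Fintype.card_fun,
      Fintype.card_fin, smul_eq_mul, mul_one]
  -- Both have degree at most `q ^ n` with the same coefficient there, so their difference has
  -- smaller degree. It vanishes at the `q ^ n` combinations of the `x l`, which are distinct by
  -- independence.
  have key : F = G := by
    refine Polynomial.eq_of_degree_sub_lt_of_eval_index_eq (v := fun c : Fin n → Fq =>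
      ∑ l, c l • x l) Finset.univ ?_ ?_ ?_
    · intro c _ c' _ h
      exact hx.fintypeLinearCombination_injective h
    · rw [degree_lt_iff_coeff_zero]
      intro m hm
      simp only [Finset.card_univ, Fintype.card_fun, Fintype.card_fin] at hm
      rw [coeff_sub, hG, coeff_C_mul, hF, finsetSum_coeff]
      simp only [coeff_C_mul, coeff_X_pow]
      rcases hm.eq_or_lt with rfl | hlt
      · rw [Finset.sum_eq_single (Fin.last n)]
        · rw [← hdeg, hprod.coeff_natDegree, hdeg]
          simp [hlast]
        · intro i _ hi
          rw [if_neg, mul_zero]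
          intro h
          apply hi
          ext
          exact (Nat.pow_right_injective hq h).symm
        · simp
      · rw [coeff_eq_zero_of_natDegree_lt (by omega), mul_zero, sub_zero]
        refine Finset.sum_eq_zero fun i _ => ?_
        rw [if_neg, mul_zero]
        have : Fintype.card Fq ^ (i : ℕ) ≤ Fintype.card Fq ^ n :=
          Nat.pow_le_pow_right hq.le (by omega)
        omega
    · intro c _
      rw [hFeval, det_moore_snoc_eq_zero, hG, eval_mul, eval_prod,
        Finset.prod_eq_zero (Finset.mem_univ c) (by rw [eval_sub, eval_X, eval_C, sub_self]), mul_zero]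
  rw [← hFeval, key, hG, eval_mul, eval_C, eval_prod]
  simp only [eval_sub, eval_X, eval_C]

end Moore

/-! ### Lower bound for the Moore determinant of an orthogonal family -/

section MooreNorm

variable {Fq : Type*} [Field Fq] [Fintype Fq] {K : Type*} [NormedField K] [Algebra Fq K]

/-- In Moore's recursion the vector of index `j` contributes `q ^ j` factors, each of norm at least
`‖x j‖` by orthogonality. -/
theorem prod_norm_pow_le_norm_det_moore {n : ℕ} (x : Fin n → K) (hx : LinearIndependent Fq x)
    (h : ∀ j, ∀ v ∈ Submodule.span Fq (x '' Set.Iio j), ‖x j‖ ≤ ‖x j - v‖) :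
    ∏ j, ‖x j‖ ^ Fintype.card Fq ^ (j : ℕ) ≤ ‖(moore Fq x).det‖ := by
  induction n with
  | zero => simp
  | succ n ih =>
    have hx' : LinearIndependent Fq (Fin.init x) :=
      hx.comp _ (Fin.castSucc_injective n)
    have h1 := ih (Fin.init x) hx' fun j v hv => h j.castSucc v <| by
      refine Submodule.span_mono ?_ hv
      rintro _ ⟨l, hl, rfl⟩
      exact ⟨l.castSucc, by simpa using hl, rfl⟩
    rw [← Fin.snoc_init_self x, det_moore_snoc _ hx', Fin.prod_univ_castSucc, norm_mul]
    simp only [Fin.snoc_castSucc, Fin.snoc_last, Fin.val_castSucc, Fin.val_last]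
    refine mul_le_mul h1 ?_ (by positivity) (norm_nonneg _)
    rw [norm_prod]
    calc ‖x (Fin.last n)‖ ^ Fintype.card Fq ^ n = ∏ _c : Fin n → Fq, ‖x (Fin.last n)‖ := by simp
      _ ≤ _ := Finset.prod_le_prod (fun _ _ => norm_nonneg _) fun c _ => by
        refine h (Fin.last n) _ (Submodule.sum_mem _ fun l _ => Submodule.smul_mem _ _ ?_)
        exact Submodule.subset_span ⟨l.castSucc, Fin.castSucc_lt_last l, rfl⟩

end MooreNorm

section Twist

variable {Fq : Type*} [Field Fq] [Fintype Fq] {K : Type*} [NormedField K] [Algebra Fq K]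

theorem coeff_twist (n : ℕ) (p : K[X]) (m : ℕ) :
    (twist Fq n p).coeff m = p.coeff m ^ Fintype.card Fq ^ n := by
  rw [twist, coe_mapRingHom, coeff_map]
  change ((FiniteField.frobeniusAlgHom Fq K) ^ n) _ = _
  rw [AlgHom.coe_pow, FiniteField.coe_frobeniusAlgHom, pow_iterate]

theorem twist_twist (m n : ℕ) (p : K[X]) : twist Fq m (twist Fq n p) = twist Fq (n + m) p := by
  ext i
  rw [coeff_twist, coeff_twist, coeff_twist, ← pow_mul, ← pow_add]

end Twist

/-! ### Balancing the rows of the Moore matrix -/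

section Scaling

variable {K : Type*} [NormedField K]

/-- Row scaling factors that turn the Moore matrix of `y` into a matrix with integral entries and
unit determinant. -/
def rowScale (q : ℕ) (y : ℕ → K) (i : ℕ) : K :=
  ∏ l ∈ Finset.range i, (y l ^ q ^ l * (y l ^ q ^ (l + 1))⁻¹)

theorem rowScale_ne_zero (q : ℕ) {y : ℕ → K} (hy : ∀ l, y l ≠ 0) (i : ℕ) :
    rowScale q y i ≠ 0 :=
  Finset.prod_ne_zero_iff.mpr fun l _ =>
    mul_ne_zero (pow_ne_zero _ (hy l)) (inv_ne_zero (pow_ne_zero _ (hy l)))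

theorem pow_mul_pow_le_pow_mul_pow {s t : ℝ} (hs : 0 ≤ s) (hst : s ≤ t) {a b : ℕ} (hab : a ≤ b) :
    t ^ a * s ^ b ≤ s ^ a * t ^ b := by
  obtain ⟨c, rfl⟩ := Nat.exists_eq_add_of_le hab
  have : s ^ c ≤ t ^ c := pow_le_pow_left₀ hs hst c
  have ht : 0 ≤ t := hs.trans hst
  calc t ^ a * s ^ (a + c) = t ^ a * s ^ a * s ^ c := by ring
    _ ≤ t ^ a * s ^ a * t ^ c := by gcongr
    _ = _ := by ring

theorem norm_rowScale_succ {q : ℕ} {y : ℕ → K} (i : ℕ) :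
    ‖rowScale q y (i + 1)‖ = ‖rowScale q y i‖ * (‖y i‖ ^ q ^ i * (‖y i‖ ^ q ^ (i + 1))⁻¹) := by
  simp [rowScale, Finset.prod_range_succ]

/-- In each column the scaled entry is largest on the diagonal: passing from row `k` to row `k + 1`
multiplies its norm by `(‖y j‖ / ‖y k‖) ^ (q ^ (k + 1) - q ^ k)`, which is at least `1` for `k < j`
and at most `1` for `k ≥ j`. -/
theorem norm_rowScale_mul_le {q : ℕ} (hq : 1 ≤ q) {y : ℕ → K} (hy : ∀ l, y l ≠ 0)
    (hmono : Monotone fun l => ‖y l‖) (i j : ℕ) :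
    ‖rowScale q y i‖ * ‖y j‖ ^ q ^ i ≤ ‖rowScale q y j‖ * ‖y j‖ ^ q ^ j := by
  have hpos : ∀ l, 0 < ‖y l‖ := fun l => norm_pos_iff.mpr (hy l)
  have hpow : ∀ k, q ^ k ≤ q ^ (k + 1) := fun k => Nat.pow_le_pow_right hq (by omega)
  have hup : ∀ k < j, ‖rowScale q y k‖ * ‖y j‖ ^ q ^ k ≤
      ‖rowScale q y (k + 1)‖ * ‖y j‖ ^ q ^ (k + 1) := by
    intro k hk
    rw [norm_rowScale_succ, mul_assoc]
    refine mul_le_mul_of_nonneg_left ?_ (norm_nonneg _)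
    have := pow_mul_pow_le_pow_mul_pow (hpos k).le (hmono hk.le) (hpow k)
    rw [mul_right_comm, ← div_eq_mul_inv, le_div_iff₀ (pow_pos (hpos k) _)]
    exact this
  have hdown : ∀ k, j ≤ k → ‖rowScale q y (k + 1)‖ * ‖y j‖ ^ q ^ (k + 1) ≤
      ‖rowScale q y k‖ * ‖y j‖ ^ q ^ k := by
    intro k hk
    rw [norm_rowScale_succ, mul_assoc]
    refine mul_le_mul_of_nonneg_left ?_ (norm_nonneg _)
    have := pow_mul_pow_le_pow_mul_pow (hpos j).le (hmono hk) (hpow k)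
    rw [mul_right_comm, ← div_eq_mul_inv, div_le_iff₀ (pow_pos (hpos k) _)]
    exact this
  rcases le_total i j with h | h
  · obtain ⟨d, rfl⟩ := Nat.exists_eq_add_of_le h
    clear h hdown
    suffices ∀ e ≤ d, ‖rowScale q y i‖ * ‖y (i + d)‖ ^ q ^ i ≤
        ‖rowScale q y (i + e)‖ * ‖y (i + d)‖ ^ q ^ (i + e) from this d le_rfl
    intro e
    induction e with
    | zero => exact fun _ => le_rfl
    | succ e ih => exact fun he => (ih (by omega)).trans (hup (i + e) (by omega))
  · induction i, h using Nat.le_induction with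
    | base => exact le_rfl
    | succ k hk ih => exact (hdown k hk).trans ih

end Scaling

/-! ### Inverting the matrix of twists over the Tate algebra -/

section Inverse

variable {Fq : Type*} [Field Fq] [Fintype Fq] {K : Type*} [NormedField K] [IsUltrametricDist K]
  [Algebra Fq K]

theorem det_mem_of_forall_mem {R : Type*} [CommRing R] (S : Subring R) {n : Type*} [Fintype n]
    [DecidableEq n] {A : Matrix n n R} (hA : ∀ i j, A i j ∈ S) : A.det ∈ S := by
  rw [Matrix.det_apply]
  exact S.sum_mem fun σ _ => by
    rw [Units.smul_def]
    exact S.zsmul_mem (S.prod_mem fun i _ => hA _ _) _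

theorem adjugate_mem_of_forall_mem {R : Type*} [CommRing R] (S : Subring R) {n : Type*} [Fintype n]
    [DecidableEq n] {A : Matrix n n R} (hA : ∀ i j, A i j ∈ S) (i j : n) : A.adjugate i j ∈ S := by
  rw [Matrix.adjugate_apply]
  refine det_mem_of_forall_mem S fun k l => ?_
  rw [Matrix.updateRow_apply]
  split_ifs
  · rw [Pi.single_apply]
    split_ifs
    exacts [S.one_mem, S.zero_mem]
  · exact hA _ _

theorem norm_coeff_mul_le {f g : PowerSeries K} {a b : ℝ} (ha : 0 ≤ a) (hb : 0 ≤ b)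
    (hf : ∀ m, ‖PowerSeries.coeff m f‖ ≤ a) (hg : ∀ m, ‖PowerSeries.coeff m g‖ ≤ b) (m : ℕ) :
    ‖PowerSeries.coeff m (f * g)‖ ≤ a * b := by
  rw [PowerSeries.coeff_mul]
  refine IsUltrametricDist.norm_sum_le_of_forall_le_of_nonneg (by positivity) fun k _ => ?_
  rw [norm_mul]
  exact mul_le_mul (hf _) (hg _) (norm_nonneg _) ha

/-- The matrix of twists of polynomials with dominant constant terms `x_j`, where `x_j` is an
orthogonal family over `𝔽_q` with nondecreasing norms, is invertible over `𝕋`, and the first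
column of its inverse has Gauss norm at most `‖x_0‖⁻¹`. -/
theorem exists_twistMatrix_mul_eq_one {n : ℕ} (x : Fin (n + 1) → K) (hx : LinearIndependent Fq x)
    (hmono : Monotone fun j => ‖x j‖)
    (horth : ∀ j, ∀ v ∈ Submodule.span Fq (x '' Set.Iio j), ‖x j‖ ≤ ‖x j - v‖)
    (h : Fin (n + 1) → K[X]) (h0 : ∀ j, (h j).coeff 0 = x j)
    (hlt : ∀ j, ∀ m ≠ 0, ‖(h j).coeff m‖ < ‖x j‖) :
    ∃ W : Matrix (Fin (n + 1)) (Fin (n + 1)) (Tate K),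
      (Matrix.of fun i j : Fin (n + 1) => twist Fq i (h j)).map (toTate K) * W = 1 ∧
        ∀ i m, ‖PowerSeries.coeff m (W i 0).1‖ ≤ ‖x 0‖⁻¹ := by
  classical
  set q := Fintype.card Fq with hq
  have hq1 : 1 ≤ q := Fintype.card_pos
  -- Extending the family to all of `ℕ` by repeating its last member keeps it nonzero and monotone
  -- in norm, and removes index bounds from the scaling.
  set y : ℕ → K := fun l => x ⟨min l n, by omega⟩ with hy
  have hyx : ∀ j : Fin (n + 1), y j = x j := fun j => by
    simp only [hy]; congr 1; ext; simp; omega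
  have hy0 : ∀ l, y l ≠ 0 := fun l => hx.ne_zero _
  have hymono : Monotone fun l => ‖y l‖ := fun k l hkl => hmono (Fin.mk_le_mk.mpr (by omega))
  set α : ℕ → K := rowScale q y with hα
  have hα0 : ∀ i, α i ≠ 0 := rowScale_ne_zero q hy0
  -- The column factors make the constant terms on the diagonal of `B'` equal to `1`.
  set β : ℕ → K := fun j => (α j * y j ^ q ^ j)⁻¹ with hβ
  have hβ0 : ∀ j, α j * y j ^ q ^ j ≠ 0 := fun j => mul_ne_zero (hα0 j) (pow_ne_zero _ (hy0 j))
  have hscale : ∀ i j, ‖α i‖ * ‖y j‖ ^ q ^ i * ‖β j‖ ≤ 1 := fun i j => by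
    rw [hβ, norm_inv, ← div_eq_mul_inv, div_le_one (norm_pos_iff.mpr (hβ0 j)), norm_mul, norm_pow]
    exact norm_rowScale_mul_le hq1 hy0 hymono i j
  set B : Matrix (Fin (n + 1)) (Fin (n + 1)) K[X] := Matrix.of fun i j => twist Fq i (h j) with hB
  set B' : Matrix (Fin (n + 1)) (Fin (n + 1)) K[X] :=
    Matrix.diagonal (fun i : Fin (n + 1) => C (α i)) * B *
      Matrix.diagonal (fun i : Fin (n + 1) => C (β i)) with hB'
  have hcoeff : ∀ i j m, (B' i j).coeff m = α i * (h j).coeff m ^ q ^ (i : ℕ) * β j := by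
    intro i j m
    rw [hB', Matrix.mul_diagonal, Matrix.diagonal_mul, coeff_mul_C, coeff_C_mul, hB,
      Matrix.of_apply, coeff_twist]
  have hmem : ∀ i j, B' i j ∈ reducesToConst K := by
    intro i j
    have hs := hscale i j
    have hα' : 0 < ‖α i‖ := norm_pos_iff.mpr (hα0 i)
    have hβ' : 0 < ‖β j‖ := norm_pos_iff.mpr (inv_ne_zero (hβ0 j))
    rw [hyx] at hs
    refine ⟨?_, fun m hm => ?_⟩
    · rw [hcoeff, h0, norm_mul, norm_mul, norm_pow]
      exact hs
    · rw [hcoeff, norm_mul, norm_mul, norm_pow]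
      refine lt_of_lt_of_le ?_ hs
      have : ‖(h j).coeff m‖ ^ q ^ (i : ℕ) < ‖x j‖ ^ q ^ (i : ℕ) :=
        pow_lt_pow_left₀ (hlt j m hm) (norm_nonneg _) (pow_pos hq1 _).ne'
      gcongr
  have hdet := det_mem_of_forall_mem (reducesToConst K) hmem
  have hconst : B'.det.coeff 0 = (∏ i : Fin (n + 1), α i) * (moore Fq x).det *
      ∏ i : Fin (n + 1), β i := by
    have h1 : B'.map constantCoeff = Matrix.diagonal (fun i : Fin (n + 1) => α i) * moore Fq x *
        Matrix.diagonal (fun i : Fin (n + 1) => β i) := by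
      ext i j
      rw [Matrix.map_apply, constantCoeff_apply, hcoeff, Matrix.mul_diagonal, Matrix.diagonal_mul,
        h0, moore, Matrix.of_apply]
    rw [← constantCoeff_apply, RingHom.map_det, RingHom.mapMatrix_apply, h1, Matrix.det_mul,
      Matrix.det_mul, Matrix.det_diagonal, Matrix.det_diagonal]
  -- Integrality gives `≤ 1`. For `≥ 1`, the row and column factors combine to `∏ ‖x i‖ ^ (-q ^ i)`,
  -- the inverse of the lower bound for the Moore determinant.
  have hnorm : ‖B'.det.coeff 0‖ = 1 := by
    refine le_antisymm hdet.1 ?_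
    have h1 := prod_norm_pow_le_norm_det_moore x hx horth
    rw [hconst, mul_right_comm, norm_mul, ← Finset.prod_mul_distrib, norm_prod]
    have h2 : ∀ i : Fin (n + 1), ‖α i * β i‖ = (‖x i‖ ^ q ^ (i : ℕ))⁻¹ := fun i => by
      rw [hβ]
      simp only [mul_inv, hyx]
      rw [mul_inv_cancel_left₀ (hα0 i), norm_inv, norm_pow]
    rw [Finset.prod_congr rfl fun i _ => h2 i, Finset.prod_inv_distrib, inv_mul_eq_div,
      one_le_div (Finset.prod_pos fun i _ => pow_pos (norm_pos_iff.mpr (hx.ne_zero i)) _)]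
    exact h1
  obtain ⟨g, hg1, hg⟩ := exists_toTate_mul_eq_one hdet hnorm
  -- Undoing the scaling: `B⁻¹ = diag(β) B'⁻¹ diag(α)`, with `B'⁻¹` replaced by the adjugate so that
  -- entries stay polynomial.
  set W₀ : Matrix (Fin (n + 1)) (Fin (n + 1)) K[X] :=
    Matrix.diagonal (fun i : Fin (n + 1) => C (β i)) * B'.adjugate *
      Matrix.diagonal (fun i : Fin (n + 1) => C (α i)) with hW₀
  have hBW : B * W₀ = B'.det • 1 := by
    have hinv : Matrix.diagonal (fun i : Fin (n + 1) => C (α i)⁻¹) *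
        Matrix.diagonal (fun i : Fin (n + 1) => C (α i)) = (1 : Matrix _ _ K[X]) := by
      rw [Matrix.diagonal_mul_diagonal, ← Matrix.diagonal_one]
      congr 1
      ext1 i
      rw [← C_mul, inv_mul_cancel₀ (hα0 i), C_1]
    calc B * W₀ = (Matrix.diagonal (fun i : Fin (n + 1) => C (α i)⁻¹) *
          Matrix.diagonal (fun i : Fin (n + 1) => C (α i))) * (B * W₀) := by
            rw [hinv, Matrix.one_mul]
      _ = Matrix.diagonal (fun i : Fin (n + 1) => C (α i)⁻¹) * (B' * B'.adjugate) *
          Matrix.diagonal (fun i : Fin (n + 1) => C (α i)) := by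
            rw [hW₀]; nth_rewrite 2 [hB']; simp only [Matrix.mul_assoc]
      _ = B'.det • 1 := by
            rw [Matrix.mul_adjugate, Matrix.mul_smul, Matrix.mul_one, Matrix.smul_mul, hinv]
  refine ⟨g • W₀.map (toTate K), ?_, fun i m => ?_⟩
  · rw [Matrix.mul_smul, ← Matrix.map_mul, hBW]
    ext1 i j
    rw [Matrix.smul_apply, Matrix.map_apply, Matrix.smul_apply, smul_eq_mul, smul_eq_mul, map_mul,
      ← mul_assoc, mul_comm g, hg1, one_mul, Matrix.one_apply, Matrix.one_apply]
    split_ifs <;> simp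
  -- In the first column of the inverse the row factor is the empty product `α 0 = 1`, so only `β i`
  -- has to be bounded; the scaled entry in row `0` gives `‖β i‖ ≤ ‖x i‖⁻¹`.
  · have hβi : ‖β i‖ ≤ ‖x 0‖⁻¹ := by
      have h1 := hscale 0 i
      have h2 : ‖x 0‖ ≤ ‖y i‖ := by rw [hyx]; exact hmono (Fin.zero_le i)
      have h3 : 0 < ‖x 0‖ := norm_pos_iff.mpr (hx.ne_zero 0)
      have h4 : α 0 = 1 := by simp [hα, rowScale]
      rw [h4, norm_one, one_mul, pow_zero, pow_one] at h1
      rw [le_inv_comm₀ (norm_pos_iff.mpr (inv_ne_zero (hβ0 i))) h3]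
      refine h2.trans ?_
      rw [← one_div, le_div_iff₀ (norm_pos_iff.mpr (inv_ne_zero (hβ0 i)))]
      exact h1
    have hW : ∀ m, ‖PowerSeries.coeff m (toTate K (W₀ i 0)).1‖ ≤ ‖x 0‖⁻¹ := by
      intro m
      change ‖PowerSeries.coeff m (W₀ i 0 : PowerSeries K)‖ ≤ _
      rw [Polynomial.coeff_coe, hW₀, Matrix.mul_diagonal, Matrix.diagonal_mul, coeff_mul_C,
        coeff_C_mul, norm_mul, norm_mul]
      have h4 : α ((0 : Fin (n + 1)) : ℕ) = 1 := by simp [hα, rowScale]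
      rw [h4, norm_one, mul_one]
      calc ‖β i‖ * ‖(B'.adjugate i 0).coeff m‖ ≤ ‖β i‖ * 1 := by
            gcongr
            exact norm_coeff_le_one_of_mem (adjugate_mem_of_forall_mem _ hmem _ _) m
        _ ≤ _ := by rwa [mul_one]
    have := norm_coeff_mul_le zero_le_one (by positivity) hg hW m
    rw [one_mul] at this
    exact this

end Inverse

/-! ### Newton polygon and strict bases -/

section Strict

variable {Fq : Type*} [Field Fq] [Fintype Fq] {K : Type*} [NormedField K] [Algebra Fq K]

-- Nonzero elements of `𝔽_q` are roots of unity.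
variable (K) in
theorem norm_algebraMap_le_one (c : Fq) : ‖algebraMap Fq K c‖ ≤ 1 := by
  rcases eq_or_ne c 0 with rfl | hc
  · simp
  have h : algebraMap Fq K c ^ (Fintype.card Fq - 1) = 1 := by
    rw [← map_pow, FiniteField.pow_card_sub_one_eq_one c hc, map_one]
  have hq : 1 < Fintype.card Fq := Fintype.one_lt_card
  refine (pow_le_one_iff_of_nonneg (norm_nonneg _) (n := Fintype.card Fq - 1) (by omega)).mp ?_
  rw [← norm_pow, h, norm_one]

theorem norm_sum_smul_lt [IsUltrametricDist K] {ι : Type*} (s : Finset ι) (c : ι → Fq) {w : ι → K}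
    {ρ : ℝ} (hρ : 0 < ρ) (hw : ∀ l ∈ s, ‖w l‖ < ρ) : ‖∑ l ∈ s, c l • w l‖ < ρ := by
  rcases s.eq_empty_or_nonempty with rfl | hs
  · simpa using hρ
  obtain ⟨l, hl, hle⟩ :=
    IsUltrametricDist.exists_norm_finsetSum_le_of_nonempty hs fun l => c l • w l
  refine hle.trans_lt ?_
  rw [Algebra.smul_def, norm_mul]
  refine lt_of_le_of_lt ?_ (hw l hl)
  exact mul_le_of_le_one_left (norm_nonneg _) (norm_algebraMap_le_one K _)

theorem one_lt_card_real (Fq : Type*) [Field Fq] [Fintype Fq] : (1 : ℝ) < Fintype.card Fq := by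
  exact_mod_cast Fintype.one_lt_card

omit [Algebra Fq K] in
theorem deg_le_deg_iff {x y : K} (hx : x ≠ 0) (hy : y ≠ 0) : deg Fq x ≤ deg Fq y ↔ ‖x‖ ≤ ‖y‖ :=
  Real.logb_le_logb (one_lt_card_real Fq) (norm_pos_iff.mpr hx) (norm_pos_iff.mpr hy)

omit [Field Fq] [Algebra Fq K] in
theorem deg_mul_pow {x y : K} (hx : x ≠ 0) (hy : y ≠ 0) (m : ℕ) :
    deg Fq (x * y ^ m) = deg Fq x + m * deg Fq y := by
  rw [deg, norm_mul, norm_pow, Real.logb_mul (norm_ne_zero_iff.mpr hx)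
    (pow_ne_zero _ (norm_ne_zero_iff.mpr hy)), Real.logb_pow, deg, deg]

namespace DrinfeldModule

variable {θ : K} {r : ℕ} (φ : DrinfeldModule K θ r)

theorem phiT_apply (y : K) :
    φ.phiT Fq y = ∑ i : Fin (r + 1), φ.coeff i * y ^ Fintype.card Fq ^ (i : ℕ) := by
  have h : ∀ (i : ℕ), ((tau Fq : Module.End Fq K) ^ i) y = y ^ Fintype.card Fq ^ i := by
    intro i
    rw [Module.End.pow_apply]
    change (⇑(FiniteField.frobeniusAlgHom Fq K))^[i] y = _
    rw [FiniteField.coe_frobeniusAlgHom, pow_iterate]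
  rw [phiT, LinearMap.sum_apply]
  refine Finset.sum_congr rfl fun i _ => ?_
  rw [Module.End.mul_apply, h, LinearMap.mulLeft_apply]

variable (Fq) in
/-- The polynomial `φ_t(X) = θ X + A_1 X^q + ⋯ + A_r X^(q^r)`. -/
def phiTPoly : K[X] := ∑ i : Fin (r + 1), C (φ.coeff i) * X ^ Fintype.card Fq ^ (i : ℕ)

theorem eval_phiTPoly (y : K) : (φ.phiTPoly Fq).eval y = φ.phiT Fq y := by
  rw [phiTPoly, eval_finsetSum, phiT_apply]
  simp

omit [Algebra Fq K] in
theorem coeff_phiTPoly_pow (i : Fin (r + 1)) :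
    (φ.phiTPoly Fq).coeff (Fintype.card Fq ^ (i : ℕ)) = φ.coeff i := by
  rw [phiTPoly, finsetSum_coeff, Finset.sum_eq_single i]
  · simp
  · intro j _ hj
    rw [coeff_C_mul, coeff_X_pow, if_neg, mul_zero]
    exact fun h => hj (Fin.ext (Nat.pow_right_injective Fintype.one_lt_card h).symm)
  · simp

omit [Field Fq] [Algebra Fq K] in
theorem coeff_phiTPoly_of_forall_ne {m : ℕ}
    (hm : ∀ i : Fin (r + 1), m ≠ Fintype.card Fq ^ (i : ℕ)) : (φ.phiTPoly Fq).coeff m = 0 := by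
  rw [phiTPoly, finsetSum_coeff]
  refine Finset.sum_eq_zero fun i _ => ?_
  rw [coeff_C_mul, coeff_X_pow, if_neg (hm i), mul_zero]

theorem mem_torsion_X {y : K} : y ∈ φ.torsion Fq X ↔ φ.phiT Fq y = 0 := by
  rw [torsion, LinearMap.mem_ker, hom, aeval_X]

variable {φ}
variable {s : ℕ} {d : Fin (s + 1) → Fin (r + 1)}

omit [Field Fq] [Algebra Fq K] in
theorem IsNewtonPolygon.exists_edge (hN : φ.IsNewtonPolygon Fq s d) (j : Fin r) :
    ∃ k : Fin s, (d k.castSucc : ℕ) ≤ j ∧ (j : ℕ) < d k.succ := by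
  by_contra! hc
  have h : ∀ k, (d k : ℕ) ≤ j := by
    intro k
    induction k using Fin.induction with
    | zero => rw [hN.first]; simp
    | succ k ih => exact hc k ih
  have := h (Fin.last s)
  rw [hN.last, Fin.val_last] at this
  omega

omit [Field Fq] [Algebra Fq K] in
theorem IsNewtonPolygon.edge_lt (hN : φ.IsNewtonPolygon Fq s d) {k l : Fin s} {a b : ℕ}
    (ha : a < d k.succ) (hb : (d l.castSucc : ℕ) ≤ b) (hlt : b < a) : l ≤ k := by
  by_contra! hkl
  have h : d k.succ ≤ d l.castSucc := hN.strictMono.monotone (Fin.le_def.mpr (by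
    rw [Fin.lt_def] at hkl; simp; omega))
  rw [Fin.le_def] at h
  omega

-- Exponentiated form of the polygon lying below all the points: on a circle whose radius is given
-- by the slope of an edge, the term at the left endpoint of that edge is maximal. This supplies the
-- dominant term for the count of zeros.
omit [Algebra Fq K] in
theorem IsNewtonPolygon.norm_coeff_mul_pow_le (hN : φ.IsNewtonPolygon Fq s d) (k : Fin s) {y : K}
    (hy : y ≠ 0) (hdeg : deg Fq y = φ.slope Fq (d k.castSucc) (d k.succ)) (i : Fin (r + 1)) :
    ‖φ.coeff i‖ * ‖y‖ ^ Fintype.card Fq ^ (i : ℕ) ≤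
      ‖φ.coeff (d k.castSucc)‖ * ‖y‖ ^ Fintype.card Fq ^ (d k.castSucc : ℕ) := by
  by_cases hi : φ.coeff i = 0
  · rw [hi, norm_zero, zero_mul]; positivity
  have hd := hN.coeff_ne_zero k.castSucc
  have h := hN.le_above k i hi
  rw [← hdeg] at h
  rw [← norm_pow, ← norm_pow, ← norm_mul, ← norm_mul, ← deg_le_deg_iff (Fq := Fq)
    (mul_ne_zero hi (pow_ne_zero _ hy)) (mul_ne_zero hd (pow_ne_zero _ hy)), deg_mul_pow hi hy,
    deg_mul_pow hd hy]
  push_cast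
  linarith

theorem IsNewtonPolygon.card_roots_le [IsUltrametricDist K] (hN : φ.IsNewtonPolygon Fq s d)
    (k : Fin s) {y : K} (hy : y ≠ 0)
    (hdeg : deg Fq y = φ.slope Fq (d k.castSucc) (d k.succ)) (S : Finset K)
    (hS : ∀ z ∈ S, ‖z‖ < ‖y‖ ∧ φ.phiT Fq z = 0) :
    S.card ≤ Fintype.card Fq ^ (d k.castSucc : ℕ) := by
  refine card_roots_le_of_dominant_coeff (P := φ.phiTPoly Fq) (norm_pos_iff.mpr hy) ?_ ?_ S
    fun z hz => ⟨(hS z hz).1, by rw [IsRoot, eval_phiTPoly, (hS z hz).2]⟩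
  · rw [coeff_phiTPoly_pow]; exact hN.coeff_ne_zero _
  · intro m
    by_cases hm : ∃ i : Fin (r + 1), m = Fintype.card Fq ^ (i : ℕ)
    · obtain ⟨i, rfl⟩ := hm
      rw [coeff_phiTPoly_pow, coeff_phiTPoly_pow]
      exact hN.norm_coeff_mul_pow_le k hy hdeg i
    · push Not at hm
      rw [coeff_phiTPoly_of_forall_ne φ hm, norm_zero, zero_mul]
      positivity

variable {x : Module.Basis (Fin r) Fq (φ.torsion Fq X)}

theorem linearIndependent_coe_basis (x : Module.Basis (Fin r) Fq (φ.torsion Fq X)) :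
    LinearIndependent Fq fun j => (x j : K) :=
  x.linearIndependent.map' (φ.torsion Fq X).subtype (Submodule.ker_subtype _)

theorem IsStrict.monotone (hx : φ.IsStrict x) : Monotone fun j => ‖(x j : K)‖ := by
  obtain ⟨s, d, hN, hd⟩ := hx
  intro i j hij
  have h0 := (linearIndependent_coe_basis x).ne_zero
  rcases hij.eq_or_lt with rfl | hlt
  · exact le_rfl
  obtain ⟨k, hk1, hk2⟩ := hN.exists_edge i
  obtain ⟨l, hl1, hl2⟩ := hN.exists_edge j
  change ‖(x i : K)‖ ≤ ‖(x j : K)‖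
  rw [← deg_le_deg_iff (Fq := Fq) (h0 i) (h0 j), hd k i hk1 hk2, hd l j hl1 hl2]
  exact hN.slope_strictMono.monotone (hN.edge_lt hl2 hk1 hlt)

/-- A strict basis of `φ[t]` is orthogonal. -/
theorem IsStrict.norm_le_norm_sub [IsUltrametricDist K] (hx : φ.IsStrict x) (j : Fin r) {v : K}
    (hv : v ∈ Submodule.span Fq ((fun j => (x j : K)) '' Set.Iio j)) :
    ‖(x j : K)‖ ≤ ‖(x j : K) - v‖ := by
  classical
  obtain ⟨s, d, hN, hd⟩ := hx
  have hli := linearIndependent_coe_basis x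
  have h0 := hli.ne_zero
  by_contra! hlt
  obtain ⟨k, hk1, hk2⟩ := hN.exists_edge j
  -- The basis vectors of index below `D` are those on earlier edges, hence strictly smaller than `x
  -- j`. If `x j - v` were also smaller, there would be `D + 1` independent small zeros of `φ_t`.
  set D : ℕ := (d k.castSucc : ℕ) with hD
  have hDr : D ≤ r := by omega
  set w : Fin D → K := fun l => (x (Fin.castLE hDr l) : K) with hw
  have hwspan : Submodule.span Fq (Set.range w) ≤
      Submodule.span Fq ((fun j => (x j : K)) '' Set.Iio j) := by
    refine Submodule.span_mono ?_
    rintro _ ⟨l, rfl⟩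
    exact ⟨Fin.castLE hDr l, Fin.lt_def.mpr (by simp; omega), rfl⟩
  have hwli : LinearIndependent Fq w := hli.comp _ (Fin.castLE_injective hDr)
  have hW : LinearIndependent Fq (Fin.snoc w ((x j : K) - v) : Fin (D + 1) → K) := by
    refine hwli.finSnoc fun hmem => ?_
    have h1 : (x j : K) ∈ Submodule.span Fq ((fun j => (x j : K)) '' Set.Iio j) := by
      have := Submodule.add_mem _ (hwspan hmem) hv
      rwa [sub_add_cancel] at this
    exact hli.notMem_span_image (by simp) h1
  have hroot : ∀ l, φ.phiT Fq (x l : K) = 0 := fun l => φ.mem_torsion_X.mp (x l).2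
  have hvroot : φ.phiT Fq v = 0 := by
    have : Submodule.span Fq ((fun j => (x j : K)) '' Set.Iio j) ≤ φ.torsion Fq X := by
      rw [Submodule.span_le]
      rintro _ ⟨l, _, rfl⟩
      exact (x l).2
    exact φ.mem_torsion_X.mp (this hv)
  have hWroot : ∀ l, φ.phiT Fq ((Fin.snoc w ((x j : K) - v) : Fin (D + 1) → K) l) = 0 := by
    intro l
    induction l using Fin.lastCases with
    | last => rw [Fin.snoc_last, map_sub, hroot, hvroot, sub_zero]
    | cast l => rw [Fin.snoc_castSucc]; exact hroot _
  have hWnorm : ∀ l, ‖(Fin.snoc w ((x j : K) - v) : Fin (D + 1) → K) l‖ < ‖(x j : K)‖ := by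
    intro l
    induction l using Fin.lastCases with
    | last => rwa [Fin.snoc_last]
    | cast l =>
      rw [Fin.snoc_castSucc]
      obtain ⟨m, hm1, hm2⟩ := hN.exists_edge (Fin.castLE hDr l)
      have hmk : m < k := by
        have h1 : d m.castSucc < d k.castSucc := Fin.lt_def.mpr (by simp at hm1; omega)
        simpa using hN.strictMono.lt_iff_lt.mp h1
      rw [← not_le, ← deg_le_deg_iff (Fq := Fq) (h0 j) (h0 _), not_le, hd k j hk1 hk2,
        hd m _ hm1 hm2]
      exact hN.slope_strictMono hmk
  -- The `q ^ (D + 1)` combinations of these vectors are distinct zeros in the open disc, which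
  -- contains at most `q ^ D`.
  have hcard := hN.card_roots_le k (h0 j) (hd k j hk1 hk2)
    (Finset.univ.image (Fintype.linearCombination Fq
      (Fin.snoc w ((x j : K) - v) : Fin (D + 1) → K))) (by
      intro z hz
      obtain ⟨c, _, rfl⟩ := Finset.mem_image.mp hz
      rw [Fintype.linearCombination_apply]
      refine ⟨norm_sum_smul_lt _ _ (norm_pos_iff.mpr (h0 j)) fun l _ => hWnorm l, ?_⟩
      rw [map_sum]
      exact Finset.sum_eq_zero fun l _ => by rw [map_smul, hWroot, smul_zero])
  rw [Finset.card_image_of_injective _ hW.fintypeLinearCombination_injective, Finset.card_univ,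
    Fintype.card_fun, Fintype.card_fin] at hcard
  have := Nat.pow_lt_pow_right (Fintype.one_lt_card (α := Fq)) (Nat.lt_succ_self D)
  exact absurd hcard (not_le.mpr this)

/-- The right endpoint of the first edge is one of the indices over which `μ` is a maximum, and its
`μ_m` is determined by the first slope, which is `deg x_0`. -/
theorem IsStrict.radius_le (hx : φ.IsStrict x) (hθ : ‖θ‖ = Fintype.card Fq) {j : Fin r}
    (hj : (j : ℕ) = 0) : φ.radius Fq ≤ ‖θ‖ * ‖(x j : K)‖ := by
  obtain ⟨s, d, hN, hd⟩ := hx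
  have h0 := (linearIndependent_coe_basis x).ne_zero
  obtain ⟨k, hk1, hk2⟩ := hN.exists_edge j
  have hq := one_lt_card_real Fq
  have hk0 : d k.castSucc = 0 := Fin.ext (by rw [Fin.val_zero]; omega)
  set m := d k.succ with hm
  have hm0 : m ≠ 0 := fun h => by rw [h, Fin.val_zero] at hk2; omega
  have hmem : m ∈ φ.support := by
    simp only [support, Finset.mem_filter, Finset.mem_univ, true_and]
    exact ⟨hm0, hN.coeff_ne_zero _⟩
  have hdeg := hd k j hk1 hk2
  have hθdeg : deg Fq θ = 1 := by
    rw [deg, hθ]; exact Real.logb_self_eq_one hq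
  have hqm : (1 : ℝ) < (Fintype.card Fq : ℝ) ^ (m : ℕ) :=
    one_lt_pow₀ hq fun h => hm0 (Fin.ext h)
  -- The first edge starts at `(1, -1)` because `deg θ = 1`, so its slope is `(1 - deg A_m) / (q ^ m
  -- - 1)`; adding `1` gives `-μ_m`.
  have hmu : -φ.mu Fq m = 1 + deg Fq (x j : K) := by
    rw [hdeg, hk0, ← hm, slope, mu, φ.coeff_zero, hθdeg, Fin.val_zero, pow_zero]
    have : (Fintype.card Fq : ℝ) ^ (m : ℕ) - 1 ≠ 0 := by linarith
    field_simp
    ring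
  calc φ.radius Fq ≤ ‖θ‖ ^ (-φ.mu Fq m) := by
        rw [radius]
        refine Real.rpow_le_rpow_of_exponent_le (by rw [hθ]; exact hq.le) ?_
        exact neg_le_neg (Finset.le_sup' (φ.mu Fq) hmem)
    _ = ‖θ‖ * ‖(x j : K)‖ := by
        rw [hmu, hθ, Real.rpow_add (by linarith), Real.rpow_one, deg,
          Real.rpow_logb (by linarith) hq.ne' (norm_pos_iff.mpr (h0 j))]

end DrinfeldModule

end Strict

/-! ### Gauss norm estimates and the inverse of `t - θ` -/

section GaussNorm

variable {K : Type*} [NormedField K] [IsUltrametricDist K]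

theorem gaussNorm_le {f : Tate K} {c : ℝ} (hf : ∀ m, ‖PowerSeries.coeff m f.1‖ ≤ c) :
    gaussNorm f ≤ c := by
  rw [gaussNorm, PowerSeries.gaussNorm_eq]
  exact ciSup_le fun m => by simpa using hf m

theorem matGaussNorm_lt {m n : ℕ} [NeZero m] [NeZero n] {F : Matrix (Fin m) (Fin n) (Tate K)}
    {c : ℝ} (hF : ∀ i j, gaussNorm (F i j) < c) : matGaussNorm F < c := by
  obtain ⟨p, hp⟩ := exists_eq_ciSup_of_finite
    (f := fun p : Fin m × Fin n => gaussNorm (F p.1 p.2))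
  rw [matGaussNorm, ← hp]
  exact hF _ _

theorem coeff_toTate (p : K[X]) (m : ℕ) : PowerSeries.coeff m (toTate K p).1 = p.coeff m :=
  Polynomial.coeff_coe p m

theorem exists_toTate_X_sub_C_mul_eq_one {θ : K} (hθ : 1 < ‖θ‖) :
    ∃ v : Tate K, toTate K (X - C θ) * v = 1 ∧ ∀ m, ‖PowerSeries.coeff m v.1‖ ≤ ‖θ‖⁻¹ := by
  have hθ0 : θ ≠ 0 := norm_pos_iff.mp (one_pos.trans hθ)
  -- `t - θ = -θ (1 - θ⁻¹ t)`, and the second factor reduces to `1`.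
  have hp : (1 - C θ⁻¹ * X : K[X]) ∈ reducesToConst K := by
    refine ⟨by simp, fun i hi => ?_⟩
    rw [coeff_sub, coeff_one, if_neg hi, zero_sub, norm_neg, coeff_C_mul, coeff_X, norm_mul]
    split_ifs
    · rw [norm_one, mul_one, norm_inv]; exact inv_lt_one_of_one_lt₀ hθ
    · simp
  obtain ⟨g, hg1, hg⟩ := exists_toTate_mul_eq_one hp (by simp)
  refine ⟨toTate K (C (-θ⁻¹)) * g, ?_, fun m => ?_⟩
  · rw [← mul_assoc, ← map_mul, ← hg1]
    congr 2
    rw [sub_mul, ← C_mul, C_neg, mul_neg, mul_neg, mul_inv_cancel₀ hθ0, C_neg, C_1]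
    ring
  · have h : ∀ m, ‖PowerSeries.coeff m (toTate K (C (-θ⁻¹))).1‖ ≤ ‖θ‖⁻¹ := fun m => by
      rw [coeff_toTate, coeff_C]
      split_ifs <;> simp
    have := norm_coeff_mul_le (by positivity) zero_le_one h hg m
    rwa [mul_one] at this

end GaussNorm

namespace DrinfeldModule

/-! ### The functional equation of `h` and the product `Θ B` -/

section Identities

variable {Fq : Type*} [Field Fq] [Fintype Fq] {K : Type*} [NormedField K] [Algebra Fq K]
  {θ : K}

theorem hom_X_pow_succ {r : ℕ} (φ : DrinfeldModule K θ r) (m : ℕ) (y : K) :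
    φ.hom Fq (X ^ (m + 1)) y = φ.phiT Fq (φ.hom Fq (X ^ m) y) := by
  rw [pow_succ', map_mul, Module.End.mul_apply, hom, aeval_X]

theorem coeff_h {r : ℕ} (φ : DrinfeldModule K θ r) (N : ℕ) (ξ : K) (m : ℕ) :
    (φ.h Fq N ξ).coeff m = if m < N then φ.hom Fq (X ^ (N - 1 - m)) ξ else 0 := by
  simp [h, finsetSum_coeff, coeff_X_pow]

/-- `φ_t(h) = t h - ξ t^N`, where `φ_t` acts through the Frobenius twists. -/
theorem sum_coeff_mul_twist_h {r : ℕ} (φ : DrinfeldModule K θ r) {N : ℕ} (hN : 1 ≤ N) {ξ : K}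
    (hξ : ξ ∈ φ.torsion Fq (X ^ N)) :
    ∑ l : Fin (r + 1), C (φ.coeff l) * twist Fq l (φ.h Fq N ξ) =
      X * φ.h Fq N ξ - C ξ * X ^ N := by
  have hξ0 : φ.hom Fq (X ^ N) ξ = 0 := hξ
  ext m
  have hl : (∑ l : Fin (r + 1), C (φ.coeff l) * twist Fq l (φ.h Fq N ξ)).coeff m =
      φ.phiT Fq ((φ.h Fq N ξ).coeff m) := by
    rw [finsetSum_coeff, phiT_apply]
    exact Finset.sum_congr rfl fun l _ => by rw [coeff_C_mul, coeff_twist]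
  rw [hl, coeff_sub, coeff_C_mul, coeff_X_pow]
  rcases m with _ | k
  · rw [coeff_X_mul_zero, if_neg (by omega), coeff_h, if_pos (by omega), ← hom_X_pow_succ,
      show N - 1 - 0 + 1 = N by omega, hξ0]
    simp
  · rw [coeff_X_mul, coeff_h, coeff_h]
    rcases lt_trichotomy (k + 1) N with h | h | h
    · rw [if_pos h, if_pos (by omega), if_neg h.ne, ← hom_X_pow_succ,
        show N - 1 - (k + 1) + 1 = N - 1 - k by omega]
      simp
    -- Degree `N` is the only place where `t h` has a coefficient not matched by `φ_t(h)`: it is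
    -- `ξ`, cancelled by `ξ t^N`.
    · rw [if_neg (by omega), if_pos (by omega), if_pos h, show N - 1 - k = 0 by omega]
      simp
    · rw [if_neg (by omega), if_neg (by omega), if_neg h.ne']
      simp

variable {n : ℕ} (φ : DrinfeldModule K θ (n + 1))

theorem matTheta_castSucc (i : Fin n) (j : Fin (n + 1)) :
    φ.matTheta i.castSucc j = if j = i.succ then 1 else 0 := by
  rw [matTheta, Matrix.of_apply, if_neg (by simp; omega)]
  simp only [Fin.ext_iff, Fin.val_castSucc, Fin.val_succ]

theorem matTheta_last_zero :
    φ.matTheta (Fin.last n) 0 = C (φ.coeff (Fin.last (n + 1)))⁻¹ * (X - C θ) := by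
  simp [matTheta]

theorem matTheta_last_succ (j : Fin n) :
    φ.matTheta (Fin.last n) j.succ =
      -C (φ.coeff j.succ.castSucc / φ.coeff (Fin.last (n + 1))) := by
  simp [matTheta]

theorem matTheta_mul_matB_castSucc (N : ℕ) (ξ : Fin (n + 1) → K) (i : Fin n) (j : Fin (n + 1)) :
    (φ.matTheta * φ.matB Fq N ξ) i.castSucc j = twist Fq 1 (φ.matB Fq N ξ i.castSucc j) := by
  rw [Matrix.mul_apply, Finset.sum_eq_single i.succ]
  · rw [matTheta_castSucc, if_pos rfl, one_mul, matB, Matrix.of_apply, Matrix.of_apply, twist_twist]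
    simp
  · intro k _ hk
    rw [matTheta_castSucc, if_neg hk, zero_mul]
  · simp

/-- The last row of `Θ` solves `φ_t(h) = t h - ξ t^N` for the top twist `h^(r)`; the truncation term
`ξ t^N` remains as the error. -/
theorem matTheta_mul_matB_last {N : ℕ} (hN : 1 ≤ N) {ξ : Fin (n + 1) → K}
    (hξ : ∀ j, ξ j ∈ φ.torsion Fq (X ^ N)) (j : Fin (n + 1)) :
    (φ.matTheta * φ.matB Fq N ξ) (Fin.last n) j =
      twist Fq 1 (φ.matB Fq N ξ (Fin.last n) j) +
        C (φ.coeff (Fin.last (n + 1)))⁻¹ * (C (ξ j) * X ^ N) := by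
  have h1 := φ.sum_coeff_mul_twist_h hN (hξ j)
  have hA : (C (φ.coeff (Fin.last (n + 1)))⁻¹ * C (φ.coeff (Fin.last (n + 1))) : K[X]) = 1 := by
    rw [← C_mul, inv_mul_cancel₀ φ.coeff_last, C_1]
  have h00 : twist Fq 0 (φ.h Fq N (ξ j)) = φ.h Fq N (ξ j) := by
    ext m; rw [coeff_twist]; simp
  rw [Fin.sum_univ_castSucc, Fin.sum_univ_succ] at h1
  simp only [Fin.val_castSucc, Fin.val_succ, Fin.val_last, Fin.val_zero, Fin.castSucc_zero,
    φ.coeff_zero, h00] at h1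
  rw [Matrix.mul_apply, Fin.sum_univ_succ, matTheta_last_zero]
  simp only [matTheta_last_succ, matB, Matrix.of_apply, Fin.val_zero, Fin.val_succ, Fin.val_last,
    twist_twist, h00, div_eq_inv_mul, C_mul]
  have h2 : ∑ k : Fin n, -(C (φ.coeff (Fin.last (n + 1)))⁻¹ * C (φ.coeff k.succ.castSucc)) *
      twist Fq ((k : ℕ) + 1) (φ.h Fq N (ξ j)) = -(C (φ.coeff (Fin.last (n + 1)))⁻¹ *
      ∑ k : Fin n, C (φ.coeff k.succ.castSucc) * twist Fq ((k : ℕ) + 1) (φ.h Fq N (ξ j))) := by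
    rw [Finset.mul_sum, ← Finset.sum_neg_distrib]
    exact Finset.sum_congr rfl fun k _ => by ring
  rw [h2]
  linear_combination (-C (φ.coeff (Fin.last (n + 1)))⁻¹) * h1 +
    twist Fq (n + 1) (φ.h Fq N (ξ j)) * hA

end Identities

/-! ### The comparison of `Θ B` with the twist of `B` -/

section Main

variable {Fq : Type*} [Field Fq] [Fintype Fq] {K : Type*} [NormedField K] [IsUltrametricDist K]
  [Algebra Fq K] {θ : K}

-- `Θ` is a companion matrix whose only pivot other than `1` is `(t - θ) / A_r`, a unit of `𝕋` since
-- `|θ| > 1`.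
omit [Fintype Fq] [Algebra Fq K] [Field Fq] in
theorem isUnit_matTheta {n : ℕ} (φ : DrinfeldModule K θ (n + 1)) (hθ : 1 < ‖θ‖) :
    IsUnit (φ.matTheta.map (toTate K)) := by
  obtain ⟨v, hv, -⟩ := exists_toTate_X_sub_C_mul_eq_one hθ
  rw [← Matrix.mulVec_surjective_iff_isUnit]
  intro w
  set Θ := φ.matTheta.map (toTate K) with hΘ
  have h0 : Θ (Fin.last n) 0 * (v * toTate K (C (φ.coeff (Fin.last (n + 1))))) = 1 := by
    rw [hΘ, Matrix.map_apply, matTheta_last_zero, map_mul]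
    calc _ = (toTate K (C (φ.coeff (Fin.last (n + 1)))⁻¹) *
        toTate K (C (φ.coeff (Fin.last (n + 1))))) * (toTate K (X - C θ) * v) := by ring
      _ = 1 := by rw [hv, mul_one, ← map_mul, ← C_mul, inv_mul_cancel₀ φ.coeff_last, C_1, map_one]
  -- Solving `Θ u = w`: the upper rows force `u_{k+1} = w_k`, and the last row then determines
  -- `u_0`.
  refine ⟨Fin.cons (v * toTate K (C (φ.coeff (Fin.last (n + 1)))) *
    (w (Fin.last n) - ∑ k : Fin n, Θ (Fin.last n) k.succ * w k.castSucc))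
    fun k => w k.castSucc, ?_⟩
  ext1 i
  rw [Matrix.mulVec, dotProduct, Fin.sum_univ_succ]
  simp only [Fin.cons_zero, Fin.cons_succ]
  induction i using Fin.lastCases with
  | last => rw [← mul_assoc, h0]; ring
  | cast i =>
    rw [hΘ]
    simp only [Matrix.map_apply, matTheta_castSucc]
    rw [if_neg (Fin.succ_ne_zero i).symm, map_zero, zero_mul, zero_add, Finset.sum_eq_single i]
    · simp
    · intro k _ hk
      rw [if_neg (fun h => hk (Fin.succ_injective _ h)), map_zero, zero_mul]
    · simp

variable {r : ℕ} {φ : DrinfeldModule K θ r} {x : Module.Basis (Fin r) Fq (φ.torsion Fq X)} {N : ℕ}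
  {ξ : Fin r → K}

omit [IsUltrametricDist K] in
theorem IsDivisionChoice.coeff_zero_h (hξ : φ.IsDivisionChoice x N ξ) (j : Fin r) :
    (φ.h Fq N (ξ j)).coeff 0 = x j := by
  rw [coeff_h, if_pos (by have := hξ.one_le; omega), Nat.sub_zero, hξ.map_eq]

-- The higher coefficients of `h` are the `φ_{t^a}(ξ_j)` with `a < N - 1`, or zero; the norms
-- increase strictly with `a` up to `x_j`.
omit [IsUltrametricDist K] in
theorem IsDivisionChoice.norm_coeff_h_lt (hξ : φ.IsDivisionChoice x N ξ) (j : Fin r) {m : ℕ}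
    (hm : m ≠ 0) : ‖(φ.h Fq N (ξ j)).coeff m‖ < ‖(x j : K)‖ := by
  have hlt : ∀ a b, a < b → b < N → ‖φ.hom Fq (X ^ a) (ξ j)‖ < ‖φ.hom Fq (X ^ b) (ξ j)‖ := by
    intro a b hab
    induction b, hab using Nat.le_induction with
    | base => exact hξ.norm_lt_norm j a
    | succ b _ ih => exact fun hb => (ih (by omega)).trans (hξ.norm_lt_norm j b hb)
  rw [coeff_h]
  split_ifs with h
  · rw [← hξ.map_eq]
    exact hlt _ _ (by omega) (by omega)
  · rw [norm_zero, norm_pos_iff]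
    exact (linearIndependent_coe_basis x).ne_zero j

/-- The comparison theorem over any ultrametric field `K ⊇ 𝔽_q` with an element `θ` of absolute
value `q`. -/
theorem IsStrict.matGaussNorm_lt_one (hx : φ.IsStrict x) (hξ : φ.IsDivisionChoice x N ξ)
    (hθ : ‖θ‖ = Fintype.card Fq) :
    IsUnit (φ.matTheta.map (toTate K)) ∧ IsUnit ((φ.matB Fq N ξ).map (toTate K)) ∧
      matGaussNorm (((φ.matB Fq N ξ).map (toTate K))⁻¹ * (φ.matTheta.map (toTate K))⁻¹ *
        ((φ.matB Fq N ξ).map (twist Fq 1)).map (toTate K) - 1) < 1 := by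
  obtain ⟨n, rfl⟩ : ∃ n, r = n + 1 := ⟨r - 1, by have := φ.rank_pos; omega⟩
  have hθ1 : 1 < ‖θ‖ := hθ ▸ one_lt_card_real Fq
  obtain ⟨W, hBW, hW⟩ := exists_twistMatrix_mul_eq_one (fun j => (x j : K))
    (linearIndependent_coe_basis x) hx.monotone (fun j v hv => hx.norm_le_norm_sub j hv)
    (fun j => φ.h Fq N (ξ j)) hξ.coeff_zero_h (fun j m hm => hξ.norm_coeff_h_lt j hm)
  change (φ.matB Fq N ξ).map (toTate K) * W = 1 at hBW
  obtain ⟨v, hv1, hv⟩ := exists_toTate_X_sub_C_mul_eq_one hθ1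
  have hΘ := φ.isUnit_matTheta hθ1
  set Θ := φ.matTheta.map (toTate K)
  set B := (φ.matB Fq N ξ).map (toTate K)
  set B₁ := ((φ.matB Fq N ξ).map (twist Fq 1)).map (toTate K)
  have hB : IsUnit B := IsUnit.of_mul_eq_one W hBW
  refine ⟨hΘ, hB, ?_⟩
  -- The last-row error `A_r⁻¹ ξ_j t^N` divided by the pivot `(t - θ) / A_r`: this is the error
  -- pulled back through `Θ`, and it sits in the first row.
  set F : Matrix (Fin (n + 1)) (Fin (n + 1)) (Tate K) :=
    Matrix.of fun i j => if i = 0 then toTate K (C (ξ j) * X ^ N) * v else 0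
  have hF : ∀ (A : Matrix (Fin (n + 1)) (Fin (n + 1)) (Tate K)) (i j : Fin (n + 1)),
      (A * F) i j = A i 0 * (toTate K (C (ξ j) * X ^ N) * v) := by
    intro A i j
    rw [Matrix.mul_apply, Finset.sum_eq_single 0]
    · simp only [F, Matrix.of_apply, if_true]
    · intro k _ hk
      simp only [F, Matrix.of_apply, if_neg hk, mul_zero]
    · simp
  have hB₁ : B₁ = Θ * (B - F) := by
    ext1 i j
    rw [Matrix.mul_sub, Matrix.sub_apply, hF, ← Matrix.map_mul]
    simp only [Θ, B₁, Matrix.map_apply]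
    induction i using Fin.lastCases with
    | last =>
      rw [matTheta_mul_matB_last φ hξ.one_le hξ.mem_torsion, matTheta_last_zero, map_add, map_mul,
        map_mul (toTate K) _ (X - C θ)]
      linear_combination (toTate K (C (φ.coeff (Fin.last (n + 1)))⁻¹) *
        toTate K (C (ξ j) * X ^ N)) * hv1
    | cast i =>
      rw [matTheta_mul_matB_castSucc, matTheta_castSucc, if_neg (Fin.succ_ne_zero i).symm, map_zero,
        zero_mul, sub_zero]
  have hdiff : B⁻¹ * Θ⁻¹ * B₁ - 1 = -(W * F) := by
    have hdΘ : IsUnit Θ.det := (Matrix.isUnit_iff_isUnit_det Θ).mp hΘ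
    have hdB : IsUnit B.det := (Matrix.isUnit_iff_isUnit_det B).mp hB
    rw [hB₁, Matrix.mul_assoc, Matrix.nonsing_inv_mul_cancel_left _ _ hdΘ, Matrix.mul_sub,
      Matrix.nonsing_inv_mul _ hdB, Matrix.inv_eq_right_inv hBW]
    abel
  rw [hdiff]
  refine matGaussNorm_lt fun i j => ?_
  have hx0 : 0 < ‖(x 0 : K)‖ := norm_pos_iff.mpr ((linearIndependent_coe_basis x).ne_zero 0)
  -- The three factors bound the first column of `B⁻¹`, the polynomial `ξ_j t^N` and `(t - θ)⁻¹`.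
  -- The product is below `1` because `‖ξ j‖ < R_φ ≤ ‖θ‖ ‖x 0‖`.
  have hbound : ‖(x 0 : K)‖⁻¹ * (‖ξ j‖ * ‖θ‖⁻¹) < 1 := by
    have h1 := (hξ.norm_lt_radius j).trans_le (hx.radius_le hθ (j := 0) (Fin.val_zero _))
    rw [← div_eq_mul_inv, inv_mul_lt_iff₀ hx0, mul_one, div_lt_iff₀ (one_pos.trans hθ1), mul_comm]
    exact h1
  refine lt_of_le_of_lt (gaussNorm_le fun m => ?_) hbound
  rw [Matrix.neg_apply, hF]
  change ‖PowerSeries.coeff m (-((W i 0).1 * ((toTate K (C (ξ j) * X ^ N)).1 * v.1)))‖ ≤ _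
  rw [map_neg, norm_neg]
  refine norm_coeff_mul_le (by positivity) (by positivity) (hW i)
    (norm_coeff_mul_le (by positivity) (by positivity) (fun k => ?_) hv) m
  rw [coeff_toTate, coeff_C_mul, coeff_X_pow]
  split_ifs <;> simp

end Main

end DrinfeldModule

end Drinfeld

end

theorem theoremT {Fq : Type*} [Field Fq] [Fintype Fq] {r : ℕ}
    (φ : Drinfeld.DrinfeldModule (Drinfeld.CInfty Fq) (Drinfeld.theta Fq) r)
    (x : Module.Basis (Fin r) Fq (φ.torsion Fq Polynomial.X)) (hx : φ.IsStrict x)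
    (N : ℕ) (ξ : Fin r → Drinfeld.CInfty Fq) (hξ : φ.IsDivisionChoice x N ξ)
    (Θ B B₁ : Matrix (Fin r) (Fin r) (Drinfeld.Tate (Drinfeld.CInfty Fq)))
    (hΘ : Θ = (φ.matTheta).map (Drinfeld.toTate (Drinfeld.CInfty Fq)))
    (hB : B = (φ.matB Fq N ξ).map (Drinfeld.toTate (Drinfeld.CInfty Fq)))
    (hB₁ : B₁ = ((φ.matB Fq N ξ).map (Drinfeld.twist Fq 1)).map
      (Drinfeld.toTate (Drinfeld.CInfty Fq))) :
    IsUnit Θ ∧ IsUnit B ∧ Drinfeld.matGaussNorm (B⁻¹ * Θ⁻¹ * B₁ - 1) < 1 := by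
  subst hΘ hB hB₁
  exact hx.matGaussNorm_lt_one hξ (Drinfeld.norm_theta Fq)
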